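/- Let $u\in L^2(\mathbb R)\cap L^\infty(\mathbb R)$ be real-valued. Let $H^+\subset L^2(\mathbb R)$ be the Hardy space of (complex-valued) $L^2$ functions whose Fourier transform vanishes a.e. on $(-\infty,0)$, let $C_+$ be the Cauchy projection of $L^2(\mathbb R)$ onto $H^+$, $\widehat{C_+\varphi}=\chi_{(0,\infty)}\hat\varphi$, and let $H^1(\mathbb R)$ be the $L^2$ Sobolev space of order $1$. Let $\frac1i\partial_x$ be the operator on $H^+$ with domain $H^+\cap H^1(\mathbb R)$, and let $$L_u\varphi=\frac1i\varphi_x-C_+(u\,C_+\varphi).$$ Then $L_u$ is a relatively compact perturbation of $\frac1i\partial_x$ on $H^+$, that is, $\frac1i\partial_x$ has nonempty resolvent set and $C_+uC_+\left(\frac1i\partial_x-z\right)^{-1}$ is a compact operator on $H^+$ for every $z$ in the resolvent set of $\frac1i\partial_x$. Moreover, $L_u$ is self-adjoint on $H^+$ with domain $H^+\cap H^1(\mathbb R)$. -/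

import Mathlib

open MeasureTheory TemperedDistribution
open scoped ENNReal FourierTransform SchwartzMap LineDeriv

noncomputable section

namespace BenjaminOno

/-- The complex Hilbert space `L²(ℝ)`. -/
abbrev L2 : Type := Lp ℂ 2 (volume : Measure ℝ)

/-- Multiplication by an essentially bounded function, as a bounded operator on `L²(ℝ)`. -/
def mulOp (m : ℝ → ℂ) (hm : MemLp m ∞ (volume : Measure ℝ)) : L2 →L[ℂ] L2 :=
  (ContinuousLinearMap.mul ℂ ℂ).holderL volume ∞ 2 2 (hm.toLp m)

theorem mulOp_coeFn (m : ℝ → ℂ) (hm : MemLp m ∞ (volume : Measure ℝ)) (f : L2) :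
    mulOp m hm f =ᵐ[volume] fun x => m x * f x := by
  have h := (ContinuousLinearMap.mul ℂ ℂ).coeFn_holder (r := 2) (hm.toLp m) f
  filter_upwards [h, hm.coeFn_toLp] with x hx hx'
  simpa [mulOp, hx'] using hx

/-- The Hardy space `H⁺`: the `L²` functions whose Fourier transform vanishes almost everywhere on
the negative half line. (This does not depend on the normalization `e^{-ixξ}` or `e^{-2πixξ}` of
the Fourier transform.) -/
def hardy : Submodule ℂ L2 where
  carrier := {f | ∀ᵐ ξ : ℝ, ξ < 0 → (𝓕 f : L2) ξ = 0}
  add_mem' := by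
    intro f g hf hg
    have h : (𝓕 (f + g) : L2) = 𝓕 f + 𝓕 g := FourierTransform.fourier_add f g
    simp only [Set.mem_ofPred_eq] at hf hg ⊢
    rw [h]
    filter_upwards [hf, hg, Lp.coeFn_add (𝓕 f : L2) (𝓕 g)] with ξ h1 h2 h3 h4
    rw [h3, Pi.add_apply, h1 h4, h2 h4, add_zero]
  zero_mem' := by
    have h : (𝓕 (0 : L2) : L2) = 0 := (Lp.fourierTransformₗᵢ ℝ ℂ).map_zero
    simp only [Set.mem_ofPred_eq]
    rw [h]
    filter_upwards [Lp.coeFn_zero ℂ 2 (volume : Measure ℝ)] with ξ h1 _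
    rw [h1, Pi.zero_apply]
  smul_mem' := by
    intro c f hf
    have h : (𝓕 (c • f) : L2) = c • 𝓕 f := FourierTransform.fourier_smul c f
    simp only [Set.mem_ofPred_eq] at hf ⊢
    rw [h]
    filter_upwards [hf, Lp.coeFn_smul c (𝓕 f : L2)] with ξ h1 h3 h4
    rw [h3, Pi.smul_apply, h1 h4, smul_zero]

theorem mem_hardy {f : L2} : f ∈ hardy ↔ ∀ᵐ ξ : ℝ, ξ < 0 → (𝓕 f : L2) ξ = 0 := Iff.rfl

theorem memLp_indicator_one {s : Set ℝ} (hs : MeasurableSet s) :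
    MemLp (s.indicator fun _ => (1 : ℂ)) ∞ (volume : Measure ℝ) :=
  (memLp_top_const (1 : ℂ)).indicator hs

theorem isClosed_hardy : IsClosed (hardy : Set L2) := by
  have h : (hardy : Set L2) =
      {f : L2 | mulOp _ (memLp_indicator_one (measurableSet_Iio (a := (0 : ℝ))))
        (Lp.fourierTransformₗᵢ ℝ ℂ f) = 0} := by
    ext f
    rw [SetLike.mem_coe, mem_hardy, Set.mem_ofPred_eq, Lp.ext_iff]
    constructor
    · intro hf
      filter_upwards [hf, Lp.coeFn_zero ℂ 2 (volume : Measure ℝ),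
        mulOp_coeFn _ (memLp_indicator_one (measurableSet_Iio (a := (0 : ℝ))))
          (Lp.fourierTransformₗᵢ ℝ ℂ f)] with ξ h1 h2 h3
      rw [h2, h3, Pi.zero_apply]
      by_cases hξ : ξ < 0
      · have h4 : (Lp.fourierTransformₗᵢ ℝ ℂ f : L2) ξ = 0 := h1 hξ
        rw [h4, mul_zero]
      · simp [hξ]
    · intro hf
      filter_upwards [hf, Lp.coeFn_zero ℂ 2 (volume : Measure ℝ),
        mulOp_coeFn _ (memLp_indicator_one (measurableSet_Iio (a := (0 : ℝ))))
          (Lp.fourierTransformₗᵢ ℝ ℂ f)] with ξ h1 h2 h3 hξ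
      rw [h2, h3, Pi.zero_apply] at h1
      simp only [Set.indicator, Set.mem_Iio, hξ, if_true, one_mul] at h1
      exact h1
  rw [h]
  exact isClosed_eq (by fun_prop) continuous_const

instance instCompleteSpaceHardy : CompleteSpace hardy := isClosed_hardy.completeSpace_coe

/-- The Cauchy projection `C₊` on `L²(ℝ)`: the Fourier multiplier with symbol `χ_{(0,∞)}`. -/
def cauchyProj : L2 →L[ℂ] L2 :=
  (Lp.fourierTransformₗᵢ ℝ ℂ).symm.toContinuousLinearEquiv.toContinuousLinearMap ∘L
    mulOp ((Set.Ioi (0 : ℝ)).indicator fun _ => 1) (memLp_indicator_one measurableSet_Ioi) ∘L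
    (Lp.fourierTransformₗᵢ ℝ ℂ).toContinuousLinearEquiv.toContinuousLinearMap

theorem fourier_cauchyProj (f : L2) :
    (𝓕 (cauchyProj f) : L2) =
      mulOp ((Set.Ioi (0 : ℝ)).indicator fun _ => 1) (memLp_indicator_one measurableSet_Ioi)
        (𝓕 f) :=
  (Lp.fourierTransformₗᵢ ℝ ℂ).apply_symm_apply _

theorem cauchyProj_mem_hardy (f : L2) : cauchyProj f ∈ hardy := by
  rw [mem_hardy, fourier_cauchyProj]
  filter_upwards [mulOp_coeFn ((Set.Ioi (0 : ℝ)).indicator fun _ => 1)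
    (memLp_indicator_one measurableSet_Ioi) (𝓕 f)] with ξ h hξ
  rw [h]
  simp [hξ.le]

/-- The bounded operator `φ ↦ C₊ (u C₊ φ)` on `H⁺`, for a bounded real function `u`. -/
def toeplitz (u : ℝ → ℝ) (hu : MemLp u ∞ (volume : Measure ℝ)) : hardy →L[ℂ] hardy :=
  (cauchyProj ∘L mulOp (fun x => (u x : ℂ)) hu.ofReal ∘L cauchyProj ∘L hardy.subtypeL).codRestrict
    hardy (fun _ => cauchyProj_mem_hardy _)

/-- The subspace `H⁺ ∩ H¹(ℝ)` of `H⁺`. -/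
def hardySobolev : Submodule ℂ hardy where
  carrier := {φ | MemSobolev 1 2 ((φ : L2) : 𝓢'(ℝ, ℂ))}
  add_mem' := by
    intro f g hf hg
    have := MemSobolev.add hf hg
    rw [← Lp.toTemperedDistributionCLM_apply, ← Lp.toTemperedDistributionCLM_apply,
      ← map_add] at this
    exact this
  zero_mem' := by
    have := memSobolev_fun_zero ℝ ℂ 1 2
    rw [← map_zero (Lp.toTemperedDistributionCLM ℂ (volume : Measure ℝ) 2)] at this
    exact this
  smul_mem' := by
    intro c f hf
    have := MemSobolev.smul c hf
    rw [← Lp.toTemperedDistributionCLM_apply, ← map_smul] at this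
    exact this

theorem mem_hardySobolev {φ : hardy} :
    φ ∈ hardySobolev ↔ MemSobolev 1 2 ((φ : L2) : 𝓢'(ℝ, ℂ)) := Iff.rfl

theorem toDistribution_injective {f g : L2} (h : (f : 𝓢'(ℝ, ℂ)) = g) : f = g :=
  LinearMap.ker_eq_bot.mp
    (Lp.ker_toTemperedDistributionCLM_eq_bot (F := ℂ) (μ := (volume : Measure ℝ)) (p := 2)) h

/-- The Fourier transform of the distributional derivative of an `L²` function. -/
theorem fourier_of_deriv_eq {f g : L2} (h : ∂_{(1 : ℝ)} (f : 𝓢'(ℝ, ℂ)) = g) :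
    (𝓕 g : L2) =ᵐ[volume] fun ξ => (2 * Real.pi * Complex.I) * ξ * (𝓕 f : L2) ξ := by
  have hw : (fun ξ : ℝ => ((((1 + ‖ξ‖ ^ 2) ^ (-1 : ℝ) : ℝ)) : ℂ)).HasTemperateGrowth := by fun_prop
  have hv : (fun ξ : ℝ => ((inner ℝ ξ (1 : ℝ) : ℝ) : ℂ)).HasTemperateGrowth := by fun_prop
  have hb : ∀ ξ : ℝ, (1 + ‖ξ‖ ^ 2) ^ (-1 : ℝ) = (1 + ξ ^ 2)⁻¹ := fun ξ => by
    rw [Real.rpow_neg_one, Real.norm_eq_abs, sq_abs]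
  have hvw := hv.mul hw
  have hwb : MemLp (fun ξ : ℝ => ((((1 + ‖ξ‖ ^ 2) ^ (-1 : ℝ) : ℝ)) : ℂ)) ∞
      (volume : Measure ℝ) := by
    refine memLp_top_of_bound hw.1.continuous.aestronglyMeasurable 1 (.of_forall fun ξ => ?_)
    rw [Complex.norm_real, hb, Real.norm_eq_abs, abs_of_nonneg (by positivity)]
    exact inv_le_one_of_one_le₀ (by nlinarith [sq_nonneg ξ])
  have hvwb : MemLp ((fun ξ : ℝ => ((inner ℝ ξ (1 : ℝ) : ℝ) : ℂ)) *
      fun ξ : ℝ => ((((1 + ‖ξ‖ ^ 2) ^ (-1 : ℝ) : ℝ)) : ℂ)) ∞ (volume : Measure ℝ) := by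
    refine memLp_top_of_bound hvw.1.continuous.aestronglyMeasurable 1 (.of_forall fun ξ => ?_)
    rw [Pi.mul_apply, norm_mul, Complex.norm_real, Complex.norm_real, hb,
      Real.norm_eq_abs (_⁻¹), abs_of_nonneg (a := (1 + ξ ^ 2)⁻¹) (by positivity),
      ← div_eq_mul_inv, div_le_one (by positivity)]
    simp only [Real.norm_eq_abs, RCLike.inner_apply, conj_trivial, one_mul]
    nlinarith [sq_nonneg (|ξ| - 1), sq_abs ξ]
  have h1 : 𝓕 (g : 𝓢'(ℝ, ℂ)) = _ := (congrArg 𝓕 h).symm.trans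
    (TemperedDistribution.fourier_lineDerivOp_eq (f : 𝓢'(ℝ, ℂ)) (1 : ℝ))
  rw [Lp.fourier_toTemperedDistribution_eq, Lp.fourier_toTemperedDistribution_eq] at h1
  have h2 := congrArg (smulLeftCLM ℂ
    (fun ξ : ℝ => ((((1 + ‖ξ‖ ^ 2) ^ (-1 : ℝ) : ℝ)) : ℂ))) h1
  rw [map_smul, smulLeftCLM_smulLeftCLM_apply hv hw,
    ← Lp.toTemperedDistribution_smul_eq (p := ∞) (q := 2) (r := 2) hw hwb,
    ← Lp.toTemperedDistribution_smul_eq (p := ∞) (q := 2) (r := 2) hvw hvwb,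
    ← Lp.toTemperedDistributionCLM_apply, ← Lp.toTemperedDistributionCLM_apply,
    ← map_smul] at h2
  have h3 := toDistribution_injective h2
  rw [Lp.ext_iff] at h3
  filter_upwards [h3, Lp.coeFn_lpSMul (r := 2) (hwb.toLp _) (𝓕 g : L2), hwb.coeFn_toLp,
    Lp.coeFn_lpSMul (r := 2) (hvwb.toLp _) (𝓕 f : L2), hvwb.coeFn_toLp,
    Lp.coeFn_smul (2 * Real.pi * Complex.I) ((hvwb.toLp _) • (𝓕 f : L2) : L2)]
    with ξ e1 e2 e3 e4 e5 e6
  rw [e2, e6, Pi.smul_apply, e4, Pi.smul_apply', Pi.smul_apply', e3, e5, Pi.mul_apply, hb] at e1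
  have hne : (((1 + ξ ^ 2)⁻¹ : ℝ) : ℂ) ≠ 0 := by
    exact_mod_cast (by positivity : (1 + ξ ^ 2)⁻¹ ≠ 0)
  simp only [RCLike.inner_apply, conj_trivial, one_mul, smul_eq_mul] at e1
  refine mul_left_cancel₀ hne (e1.trans ?_)
  ring

/-- Functions in `H⁺ ∩ H¹(ℝ)` have their weak derivative in `H⁺`. -/
theorem exists_deriv (φ : hardySobolev) :
    ∃ g : hardy, ∂_{(1 : ℝ)} (((φ : hardy) : L2) : 𝓢'(ℝ, ℂ)) = (g : L2) := by
  have h := MemSobolev.lineDerivOp (mem_hardySobolev.mp φ.2) (m := (1 : ℝ))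
  rw [sub_self, memSobolev_zero_iff] at h
  obtain ⟨g, hg⟩ := h
  refine ⟨⟨g, ?_⟩, hg⟩
  rw [mem_hardy]
  filter_upwards [fourier_of_deriv_eq hg, mem_hardy.mp (φ : hardy).2] with ξ h1 h2 h3
  rw [h1, h2 h3, mul_zero]

/-- The weak derivative `φ_x ∈ H⁺` of `φ ∈ H⁺ ∩ H¹(ℝ)`. -/
def weakDeriv (φ : hardySobolev) : hardy := (exists_deriv φ).choose

theorem weakDeriv_spec (φ : hardySobolev) :
    ∂_{(1 : ℝ)} (((φ : hardy) : L2) : 𝓢'(ℝ, ℂ)) = (weakDeriv φ : L2) :=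
  (exists_deriv φ).choose_spec

theorem weakDeriv_eq {φ : hardySobolev} {g : hardy}
    (h : ∂_{(1 : ℝ)} (((φ : hardy) : L2) : 𝓢'(ℝ, ℂ)) = (g : L2)) : weakDeriv φ = g :=
  Subtype.ext (toDistribution_injective ((weakDeriv_spec φ).symm.trans h))

/-- The operator `(1/i) ∂_x` on `H⁺` with domain `H⁺ ∩ H¹(ℝ)`. -/
def freeOp : hardy →ₗ.[ℂ] hardy where
  domain := hardySobolev
  toFun :=
    { toFun := fun φ => (1 / Complex.I) • weakDeriv φ
      map_add' := by
        intro φ ψ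
        rw [← smul_add]
        congr 1
        apply weakDeriv_eq
        have h : ∀ f g : L2, ((f + g : L2) : 𝓢'(ℝ, ℂ)) = (f : 𝓢'(ℝ, ℂ)) + g :=
          map_add (Lp.toTemperedDistributionCLM ℂ (volume : Measure ℝ) 2)
        simp only [Submodule.coe_add, h, LineDeriv.lineDerivOp_add, weakDeriv_spec]
      map_smul' := by
        intro c φ
        rw [RingHom.id_apply, smul_comm c]
        congr 1
        apply weakDeriv_eq
        have h : ∀ f : L2, ((c • f : L2) : 𝓢'(ℝ, ℂ)) = c • (f : 𝓢'(ℝ, ℂ)) :=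
          map_smul (Lp.toTemperedDistributionCLM ℂ (volume : Measure ℝ) 2) c
        simp only [Submodule.coe_smul, h, LineDeriv.lineDerivOp_smul, weakDeriv_spec] }

/-- The everywhere defined operator `C₊ u C₊` on `H⁺`. -/
def potential (u : ℝ → ℝ) (hu : MemLp u ∞ (volume : Measure ℝ)) : hardy →ₗ.[ℂ] hardy :=
  (toeplitz u hu : hardy →ₗ[ℂ] hardy).toPMap ⊤

/-- The Lax operator `L_u = (1/i) ∂_x - C₊ u C₊`; the domain of a difference is the intersection of
the two domains. -/
def laxOp (u : ℝ → ℝ) (hu : MemLp u ∞ (volume : Measure ℝ)) : hardy →ₗ.[ℂ] hardy :=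
  freeOp - potential u hu

section RelativelyCompact

variable {E : Type*} [NormedAddCommGroup E] [NormedSpace ℂ E]

/-- The bounded operator `R` is the resolvent `(A - z)⁻¹` of the unbounded operator `A`. -/
structure IsResolventAt (A : E →ₗ.[ℂ] E) (z : ℂ) (R : E →L[ℂ] E) : Prop where
  mem_domain : ∀ f : E, R f ∈ A.domain
  right_inv : ∀ f : E, A ⟨R f, mem_domain f⟩ - z • R f = f
  left_inv : ∀ φ : A.domain, R (A φ - z • (φ : E)) = φ

/-- `B` is relatively compact with respect to `A`: the domain of `B` contains that of `A`, the
resolvent set of `A` is nonempty, and `B (A - z)⁻¹` is a compact operator for every `z` in it. -/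
def IsRelativelyCompact (A B : E →ₗ.[ℂ] E) : Prop :=
  ∃ hAB : A.domain ≤ B.domain,
    (∃ (z : ℂ) (R : E →L[ℂ] E), IsResolventAt A z R) ∧
    ∀ (z : ℂ) (R : E →L[ℂ] E) (hR : IsResolventAt A z R),
      IsCompactOperator fun f : E => B ⟨R f, hAB (hR.mem_domain f)⟩

end RelativelyCompact

end BenjaminOno

end

/-! By Plancherel, the free operator is multiplication by the real function 2πξ on the frequencies ξ
> 0. It is therefore symmetric, and its resolvents at ±2πi are the Fourier multipliers (2π(ξ ∓
i))⁻¹, which are bounded multiples of the Bessel symbol (1 + ξ²)^(-1/2) and hence map into H¹.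

Relative compactness rests on `isCompactOperator_mulOp_comp_fourierMul`: for u and m in L², the
operator u(x) m(D) sends f to u(x)⟨k_x, 𝓕 f⟩ with ‖k_x‖ = ‖m‖₂. It thus has a square integrable
family of functionals as kernel and is a norm limit of finite rank operators. The Bessel symbol is
in L², and C₊ commutes with multipliers, so u can be placed next to it. The first resolvent identity
then carries compactness from 2πi to every z in the resolvent set.

Self-adjointness is `isSelfAdjoint_sub_of_isResolventAt`: subtracting a bounded symmetric operator
does not enlarge the domain of the adjoint, because A - z and A - conj z are both onto. -/

namespace BenjaminOno

/-! ### Resolvents and self-adjointness of symmetric operators -/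

section Abstract

variable {H : Type*} [NormedAddCommGroup H]

/-- The first resolvent identity. -/
theorem IsResolventAt.apply_eq [NormedSpace ℂ H] {A : H →ₗ.[ℂ] H} {z w : ℂ} {R S : H →L[ℂ] H}
    (hR : IsResolventAt A z R) (hS : IsResolventAt A w S) (f : H) :
    S f = R (f + (w - z) • S f) := by
  have h := hR.left_inv ⟨S f, hS.mem_domain f⟩
  rw [← sub_add_sub_cancel _ (w • S f), hS.right_inv f, ← sub_smul] at h
  exact h.symm

variable [InnerProductSpace ℂ H]

/-- A symmetric operator with resolvents at `z` and `conj z` has dense domain. -/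
theorem dense_domain_of_isResolventAt [CompleteSpace H] {A : H →ₗ.[ℂ] H} {z : ℂ}
    {R S : H →L[ℂ] H} (hA : A.IsFormalAdjoint A) (hR : IsResolventAt A z R)
    (hS : IsResolventAt A (starRingEnd ℂ z) S) : Dense (A.domain : Set H) := by
  rw [Submodule.dense_iff_topologicalClosure_eq_top,
    Submodule.topologicalClosure_eq_top_iff, Submodule.eq_bot_iff]
  intro g hg
  -- Symmetry on the pair R f, S g says ⟨f, S g⟩ = ⟨R f, g⟩, the terms in conj z cancelling; the
  -- right side vanishes as g is orthogonal to the domain. Then S g = 0, and S is injective.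
  have hRS : ∀ f, inner ℂ f (S g) = 0 := fun f => by
    have h1 := hA ⟨R f, hR.mem_domain f⟩ ⟨S g, hS.mem_domain g⟩
    rw [← sub_add_cancel (A ⟨R f, _⟩) (z • R f), hR.right_inv f,
      ← sub_add_cancel (A ⟨S g, _⟩) (starRingEnd ℂ z • S g), hS.right_inv g,
      inner_add_left, inner_add_right, inner_smul_left, inner_smul_right,
      (Submodule.mem_orthogonal _ _).mp hg _ (hR.mem_domain f), zero_add] at h1
    simpa using h1
  have h0 : S g = 0 := inner_self_eq_zero.mp (hRS (S g))
  have h := hS.right_inv g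
  have h2 : A ⟨S g, hS.mem_domain g⟩ = 0 := by
    rw [show (⟨S g, hS.mem_domain g⟩ : A.domain) = 0 from Subtype.ext h0, A.map_zero]
  rw [h2, h0, smul_zero, sub_zero] at h
  exact h.symm

/-- If `A` is symmetric with resolvents at `z` and `conj z`, and `B` is bounded and symmetric, then
`A - B` is self-adjoint. -/
theorem isSelfAdjoint_sub_of_isResolventAt [CompleteSpace H] {A : H →ₗ.[ℂ] H} {z : ℂ}
    {R S : H →L[ℂ] H} (hA : A.IsFormalAdjoint A) (hR : IsResolventAt A z R)
    (hS : IsResolventAt A (starRingEnd ℂ z) S) {B : H →L[ℂ] H}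
    (hB : (B : H →ₗ[ℂ] H).IsSymmetric) :
    IsSelfAdjoint (A - (B : H →ₗ[ℂ] H).toPMap ⊤) := by
  set L := A - (B : H →ₗ[ℂ] H).toPMap ⊤ with hL
  have hmem : ∀ {x : H}, x ∈ A.domain → x ∈ L.domain := fun hx => ⟨hx, trivial⟩
  have happ : ∀ (x : H) (hx : x ∈ A.domain), L ⟨x, hmem hx⟩ = A ⟨x, hx⟩ - B x := fun _ _ => rfl
  have hdense : Dense (L.domain : Set H) :=
    (dense_domain_of_isResolventAt hA hR hS).mono fun _ hx => hmem hx
  have hsymm : L.IsFormalAdjoint L := by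
    rintro ⟨x, hx⟩ ⟨y, hy⟩
    rw [happ x hx.1, happ y hy.1, inner_sub_left, inner_sub_right, hA ⟨x, hx.1⟩ ⟨y, hy.1⟩]
    congr 1
    exact hB x y
  rw [LinearPMap.isSelfAdjoint_def]
  refine (LinearPMap.eq_of_le_of_domain_eq (hsymm.le_adjoint hdense) ?_).symm
  refine le_antisymm (hsymm.le_adjoint hdense).1 fun y hy => ?_
  -- If y were in the domain of A, this would be (A - conj z) y. So S v is the only candidate for y,
  -- and y = S v is checked by testing against f = (A - z) R f.
  set v := L.adjoint ⟨y, hy⟩ + B y - starRingEnd ℂ z • y with hv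
  have key : ∀ f, inner ℂ f (y - S v) = 0 := fun f => by
    have h1 := (LinearPMap.adjoint_isFormalAdjoint hdense).symm ⟨R f, hmem (hR.mem_domain f)⟩
      ⟨y, hy⟩
    rw [happ _ (hR.mem_domain f), inner_sub_left] at h1
    have h2 := hA ⟨R f, hR.mem_domain f⟩ ⟨S v, hS.mem_domain v⟩
    have h3 := hB (R f) y
    have h4 : inner ℂ (R f) v = inner ℂ (R f) (A ⟨S v, hS.mem_domain v⟩ -
      starRingEnd ℂ z • S v) := by rw [hS.right_inv]
    rw [hv, inner_sub_right, inner_add_right, inner_sub_right, inner_smul_right,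
      inner_smul_right] at h4
    have h5 := hR.right_inv f
    conv_lhs => rw [← h5]
    rw [inner_sub_left, inner_smul_left, inner_sub_right, inner_sub_right]
    simp only [ContinuousLinearMap.coe_coe] at h1 h2 h3
    linear_combination h1 - h2 + h3 + h4
  have h0 : y - S v = 0 := inner_self_eq_zero.mp (key _)
  rw [sub_eq_zero.mp h0]
  exact hmem (hS.mem_domain v)

end Abstract

/-! ### Compactness from a square integrable kernel -/

section Kernel

variable {α H : Type*} [MeasurableSpace α] {μ : Measure α} [NormedAddCommGroup H] [NormedSpace ℂ H]

/-- A square integrable family `K` of bounded functionals induces a compact operator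
`f ↦ (x ↦ K x f)` into `L²`. -/
theorem isCompactOperator_compLpL₂_flip (K : Lp (H →L[ℂ] ℂ) 2 μ) :
    IsCompactOperator
      ((((ContinuousLinearMap.apply ℂ ℂ : H →L[ℂ] (H →L[ℂ] ℂ) →L[ℂ] ℂ)).compLpL₂ 2 μ).flip K) := by
  set T := (((ContinuousLinearMap.apply ℂ ℂ : H →L[ℂ] (H →L[ℂ] ℂ) →L[ℂ] ℂ)).compLpL₂ 2 μ).flip
  -- The operator depends continuously on K, and compact operators are closed in norm, so simple
  -- kernels suffice. A kernel equal to c on s and 0 elsewhere gives f ↦ c(f) 1_s, of rank at most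
  -- one.
  induction K using Lp.induction (p := 2) ENNReal.ofNat_ne_top with
  | @indicatorConst c s hs hμs =>
    have h : T (Lp.simpleFunc.indicatorConst 2 hs hμs.ne c : Lp (H →L[ℂ] ℂ) 2 μ) =
        (ContinuousLinearMap.toSpanSingleton ℂ (indicatorConstLp 2 hs hμs.ne (1 : ℂ))) ∘L c := by
      ext1 f
      apply Lp.ext
      rw [Lp.simpleFunc.coe_indicatorConst]
      filter_upwards [((ContinuousLinearMap.apply ℂ ℂ : H →L[ℂ] (H →L[ℂ] ℂ) →L[ℂ] ℂ) f).coeFn_compLp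
        (indicatorConstLp 2 hs hμs.ne c : Lp (H →L[ℂ] ℂ) 2 μ),
        indicatorConstLp_coeFn (p := 2) (hs := hs) (hμs := hμs.ne) (c := c),
        indicatorConstLp_coeFn (p := 2) (hs := hs) (hμs := hμs.ne) (c := (1 : ℂ)),
        Lp.coeFn_smul (c f) (indicatorConstLp 2 hs hμs.ne (1 : ℂ))] with x h1 h2 h3 h4
      rw [ContinuousLinearMap.comp_apply, ContinuousLinearMap.toSpanSingleton_apply, h4,
        Pi.smul_apply, h3]
      refine h1.trans ?_
      rw [h2]
      by_cases hx : x ∈ s <;> simp [hx]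
    rw [h]
    exact (isCompactOperator_of_locallyCompactSpace_dom c).clm_comp
      (ContinuousLinearMap.toSpanSingleton ℂ (indicatorConstLp 2 hs hμs.ne (1 : ℂ)))
  | add hf hg _ h1 h2 =>
    rw [map_add]
    exact h1.add h2
  | isClosed => exact isClosed_setOfPred_isCompactOperator.preimage T.continuous

end Kernel

/-! ### Fourier multipliers on L² and on the Hardy space -/

/-- The Fourier multiplier with essentially bounded symbol `m`, as a bounded operator on `L²(ℝ)`. -/
noncomputable def fourierMul (m : ℝ → ℂ) (hm : MemLp m ∞ (volume : Measure ℝ)) : L2 →L[ℂ] L2 :=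
  (Lp.fourierTransformₗᵢ ℝ ℂ).symm.toContinuousLinearEquiv.toContinuousLinearMap ∘L
    mulOp m hm ∘L
    (Lp.fourierTransformₗᵢ ℝ ℂ).toContinuousLinearEquiv.toContinuousLinearMap

theorem fourier_fourierMul (m : ℝ → ℂ) (hm : MemLp m ∞ (volume : Measure ℝ)) (f : L2) :
    (𝓕 (fourierMul m hm f) : L2) = mulOp m hm (𝓕 f) :=
  (Lp.fourierTransformₗᵢ ℝ ℂ).apply_symm_apply _

theorem fourierMul_coeFn (m : ℝ → ℂ) (hm : MemLp m ∞ (volume : Measure ℝ)) (f : L2) :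
    (𝓕 (fourierMul m hm f) : L2) =ᵐ[volume] fun ξ => m ξ * (𝓕 f : L2) ξ := by
  rw [fourier_fourierMul]
  exact mulOp_coeFn m hm _

theorem eq_of_fourier_ae_eq {f g : L2} (h : (𝓕 f : L2) =ᵐ[volume] (𝓕 g : L2)) : f = g :=
  (Lp.fourierTransformₗᵢ ℝ ℂ).injective (Lp.ext h)

theorem cauchyProj_eq_fourierMul : cauchyProj =
    fourierMul ((Set.Ioi (0 : ℝ)).indicator fun _ => 1) (memLp_indicator_one measurableSet_Ioi) :=
  rfl

theorem fourierMul_comm {m n : ℝ → ℂ} (hm : MemLp m ∞ (volume : Measure ℝ))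
    (hn : MemLp n ∞ (volume : Measure ℝ)) (f : L2) :
    fourierMul m hm (fourierMul n hn f) = fourierMul n hn (fourierMul m hm f) := by
  apply eq_of_fourier_ae_eq
  filter_upwards [fourierMul_coeFn m hm (fourierMul n hn f), fourierMul_coeFn n hn f,
    fourierMul_coeFn n hn (fourierMul m hm f), fourierMul_coeFn m hm f] with ξ h1 h2 h3 h4
  rw [h1, h2, h3, h4]
  ring

theorem fourierMul_mul {m n k : ℝ → ℂ} (hm : MemLp m ∞ (volume : Measure ℝ))
    (hn : MemLp n ∞ (volume : Measure ℝ)) (hk : MemLp k ∞ (volume : Measure ℝ))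
    (h : ∀ ξ, k ξ = m ξ * n ξ) (f : L2) :
    fourierMul k hk f = fourierMul m hm (fourierMul n hn f) := by
  apply eq_of_fourier_ae_eq
  filter_upwards [fourierMul_coeFn m hm (fourierMul n hn f), fourierMul_coeFn n hn f,
    fourierMul_coeFn k hk f] with ξ h1 h2 h3
  rw [h1, h2, h3, h, mul_assoc]

theorem fourierMul_mem_hardy (m : ℝ → ℂ) (hm : MemLp m ∞ (volume : Measure ℝ)) {f : L2}
    (hf : f ∈ hardy) : fourierMul m hm f ∈ hardy := by
  rw [mem_hardy] at hf ⊢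
  filter_upwards [fourierMul_coeFn m hm f, hf] with ξ h1 h2 hξ
  rw [h1, h2 hξ, mul_zero]

/-! ### Symmetry of the Toeplitz operator and of the free operator -/

/-- Multiplication by a real-valued function is symmetric. -/
theorem inner_mulOp_left {m : ℝ → ℂ} (hm : MemLp m ∞ (volume : Measure ℝ))
    (hreal : ∀ x, starRingEnd ℂ (m x) = m x) (f g : L2) :
    inner ℂ (mulOp m hm f) g = inner ℂ f (mulOp m hm g) := by
  rw [L2.inner_def, L2.inner_def]
  refine integral_congr_ae ?_
  filter_upwards [mulOp_coeFn m hm f, mulOp_coeFn m hm g] with x h1 h2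
  simp only [h1, h2, RCLike.inner_apply, map_mul, hreal]
  ring

theorem inner_cauchyProj_left (f g : L2) :
    inner ℂ (cauchyProj f) g = inner ℂ f (cauchyProj g) := by
  rw [← Lp.inner_fourier_eq, ← Lp.inner_fourier_eq f, fourier_cauchyProj, fourier_cauchyProj]
  refine inner_mulOp_left _ (fun x => ?_) _ _
  by_cases hx : 0 < x <;> simp [hx]

theorem toeplitz_isSymmetric (u : ℝ → ℝ) (hu : MemLp u ∞ (volume : Measure ℝ)) :
    (toeplitz u hu : hardy →ₗ[ℂ] hardy).IsSymmetric := by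
  intro f g
  change inner ℂ (cauchyProj (mulOp (fun x => (u x : ℂ)) hu.ofReal (cauchyProj f))) (g : L2) =
    inner ℂ (f : L2) (cauchyProj (mulOp (fun x => (u x : ℂ)) hu.ofReal (cauchyProj g)))
  rw [inner_cauchyProj_left, inner_mulOp_left _ (fun x => Complex.conj_ofReal _),
    inner_cauchyProj_left]

/-- The normalization e^{-2πixξ} turns ∂_x into 2πiξ, and the factor 1/i makes the symbol real,
whence the symmetry of `freeOp`. -/
theorem freeOp_coeFn (φ : freeOp.domain) :
    (𝓕 (freeOp φ : L2) : L2) =ᵐ[volume]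
      fun ξ => (2 * Real.pi * ξ : ℝ) * (𝓕 ((φ : hardy) : L2) : L2) ξ := by
  have h : (𝓕 (freeOp φ : L2) : L2) = (1 / Complex.I) • (𝓕 (weakDeriv φ : L2) : L2) :=
    FourierTransform.fourier_smul (1 / Complex.I) (weakDeriv φ : L2)
  rw [h]
  filter_upwards [Lp.coeFn_smul (1 / Complex.I) (𝓕 (weakDeriv φ : L2) : L2),
    fourier_of_deriv_eq (weakDeriv_spec φ)] with ξ h1 h2
  rw [h1, Pi.smul_apply, h2, smul_eq_mul]
  push_cast
  field_simp

theorem freeOp_isFormalAdjoint : freeOp.IsFormalAdjoint freeOp := by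
  intro φ ψ
  change inner ℂ (freeOp φ : L2) ((ψ : hardy) : L2) = inner ℂ ((φ : hardy) : L2) (freeOp ψ : L2)
  rw [← Lp.inner_fourier_eq, ← Lp.inner_fourier_eq ((φ : hardy) : L2), L2.inner_def, L2.inner_def]
  refine integral_congr_ae ?_
  filter_upwards [freeOp_coeFn φ, freeOp_coeFn ψ] with ξ h1 h2
  simp only [h1, h2, RCLike.inner_apply, map_mul, Complex.conj_ofReal]
  ring

/-! ### Bessel potential and the free resolvent at ±2πi -/

/-- The symbol `(1 + ξ²)^(-1/2)` of the Bessel potential of order `-1`. -/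
noncomputable def besselSymbol (ξ : ℝ) : ℂ := (((1 + ‖ξ‖ ^ 2) ^ ((-1 : ℝ) / 2) : ℝ) : ℂ)

theorem hasTemperateGrowth_besselSymbol : besselSymbol.HasTemperateGrowth := by
  unfold besselSymbol
  fun_prop

theorem norm_besselSymbol (ξ : ℝ) : ‖besselSymbol ξ‖ = (√(1 + ξ ^ 2))⁻¹ := by
  rw [besselSymbol, Complex.norm_real, Real.norm_of_nonneg (by positivity), Real.norm_eq_abs,
    sq_abs, neg_div, Real.rpow_neg (by positivity), Real.sqrt_eq_rpow]

theorem memLp_top_besselSymbol : MemLp besselSymbol ∞ (volume : Measure ℝ) := by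
  refine memLp_top_of_bound hasTemperateGrowth_besselSymbol.1.continuous.aestronglyMeasurable 1
    (.of_forall fun ξ => ?_)
  rw [norm_besselSymbol]
  exact inv_le_one_of_one_le₀ (Real.one_le_sqrt.mpr (by nlinarith [sq_nonneg ξ]))

theorem memLp_two_besselSymbol : MemLp besselSymbol 2 (volume : Measure ℝ) := by
  rw [memLp_two_iff_integrable_sq_norm
    hasTemperateGrowth_besselSymbol.1.continuous.aestronglyMeasurable]
  refine integrable_inv_one_add_sq.congr (.of_forall fun ξ => ?_)
  simp only [norm_besselSymbol, inv_pow]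
  rw [Real.sq_sqrt (by positivity)]

theorem toTemperedDistribution_fourierMul_besselSymbol (f : L2) :
    ((fourierMul besselSymbol memLp_top_besselSymbol f : L2) : 𝓢'(ℝ, ℂ)) =
      besselPotential ℝ ℂ (-1) (f : 𝓢'(ℝ, ℂ)) := by
  have h : mulOp besselSymbol memLp_top_besselSymbol (𝓕 f : L2) =
      (memLp_top_besselSymbol.toLp _ • (𝓕 f : L2) : L2) := by
    apply Lp.ext
    filter_upwards [mulOp_coeFn besselSymbol memLp_top_besselSymbol (𝓕 f : L2),
      Lp.coeFn_lpSMul (r := 2) (memLp_top_besselSymbol.toLp _) (𝓕 f : L2),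
      memLp_top_besselSymbol.coeFn_toLp] with ξ h1 h2 h3
    rw [h1, h2, Pi.smul_apply', h3, smul_eq_mul]
  change ((𝓕⁻ (mulOp besselSymbol memLp_top_besselSymbol (𝓕 f : L2)) : L2) : 𝓢'(ℝ, ℂ)) = _
  rw [h, ← Lp.fourierInv_toTemperedDistribution_eq,
    Lp.toTemperedDistribution_smul_eq hasTemperateGrowth_besselSymbol,
    ← Lp.fourier_toTemperedDistribution_eq, besselPotential, fourierMultiplierCLM_apply]
  rfl

theorem memSobolev_fourierMul_besselSymbol (f : L2) :
    MemSobolev 1 2 ((fourierMul besselSymbol memLp_top_besselSymbol f : L2) : 𝓢'(ℝ, ℂ)) := by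
  -- The Bessel potential of order 1 undoes the one of order -1, so f itself is the L² witness.
  refine ⟨f, ?_⟩
  rw [toTemperedDistribution_fourierMul_besselSymbol]
  simp

/-- The symbol `(2π (ξ - c i))⁻¹` of the resolvent of `(1/i) ∂_x` at `2π c i`. -/
noncomputable def resolventSymbol (c : ℝ) (ξ : ℝ) : ℂ := (2 * Real.pi * (ξ - c * Complex.I))⁻¹

/-- The condition `c ^ 2 = 1` treats c = 1 and c = -1 together: self-adjointness needs resolvents at
two conjugate points. -/
theorem sub_mul_I_ne_zero {c : ℝ} (hc : c ^ 2 = 1) (ξ : ℝ) : (ξ : ℂ) - c * Complex.I ≠ 0 := by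
  intro h
  have := congrArg Complex.im h
  simp at this
  simp [this] at hc

theorem continuous_resolventSymbol {c : ℝ} (hc : c ^ 2 = 1) : Continuous (resolventSymbol c) := by
  unfold resolventSymbol
  refine Continuous.inv₀ (by fun_prop) fun ξ => ?_
  exact mul_ne_zero (by simp [Real.pi_ne_zero]) (sub_mul_I_ne_zero hc ξ)

theorem norm_resolventSymbol {c : ℝ} (hc : c ^ 2 = 1) (ξ : ℝ) :
    ‖resolventSymbol c ξ‖ = (2 * Real.pi)⁻¹ * (√(1 + ξ ^ 2))⁻¹ := by
  have h : ‖(ξ : ℂ) - c * Complex.I‖ = √(1 + ξ ^ 2) := by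
    rw [Complex.norm_def, Complex.normSq_apply]
    congr 1
    simp
    linear_combination hc
  rw [resolventSymbol, norm_inv, norm_mul, h, mul_inv]
  simp [abs_of_pos Real.pi_pos]

theorem memLp_top_resolventSymbol {c : ℝ} (hc : c ^ 2 = 1) :
    MemLp (resolventSymbol c) ∞ (volume : Measure ℝ) := by
  refine memLp_top_of_bound (continuous_resolventSymbol hc).aestronglyMeasurable (2 * Real.pi)⁻¹
    (.of_forall fun ξ => ?_)
  rw [norm_resolventSymbol hc]
  exact mul_le_of_le_one_right (by positivity)
    (inv_le_one_of_one_le₀ (Real.one_le_sqrt.mpr (by nlinarith [sq_nonneg ξ])))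

theorem besselSymbol_ne_zero (ξ : ℝ) : besselSymbol ξ ≠ 0 := by
  rw [← norm_pos_iff, norm_besselSymbol]
  positivity

/-- The quotient has constant modulus 1/(2π), since |ξ - ci|² = 1 + ξ². Splitting off the Bessel
symbol serves twice: it puts the range of the resolvent in H¹ and supplies the square integrable
factor for compactness. -/
theorem memLp_top_resolventSymbol_div {c : ℝ} (hc : c ^ 2 = 1) :
    MemLp (fun ξ => resolventSymbol c ξ / besselSymbol ξ) ∞ (volume : Measure ℝ) := by
  refine memLp_top_of_bound ((continuous_resolventSymbol hc).div
    hasTemperateGrowth_besselSymbol.1.continuous besselSymbol_ne_zero).aestronglyMeasurable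
    (2 * Real.pi)⁻¹ (.of_forall fun ξ => ?_)
  rw [norm_div, norm_resolventSymbol hc, norm_besselSymbol, mul_div_cancel_right₀]
  positivity

theorem fourierMul_resolventSymbol {c : ℝ} (hc : c ^ 2 = 1) (f : L2) :
    fourierMul (resolventSymbol c) (memLp_top_resolventSymbol hc) f =
      fourierMul besselSymbol memLp_top_besselSymbol
        (fourierMul _ (memLp_top_resolventSymbol_div hc) f) :=
  fourierMul_mul _ _ _ (fun ξ => (mul_div_cancel₀ _ (besselSymbol_ne_zero ξ)).symm) f

/-- The resolvent of `(1/i) ∂_x` at `2π c i`, where `c = ±1`. -/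
noncomputable def freeResolvent (c : ℝ) (hc : c ^ 2 = 1) : hardy →L[ℂ] hardy :=
  (fourierMul (resolventSymbol c) (memLp_top_resolventSymbol hc) ∘L hardy.subtypeL).codRestrict
    hardy (fun f => fourierMul_mem_hardy _ _ f.2)

theorem coe_freeResolvent {c : ℝ} (hc : c ^ 2 = 1) (f : hardy) :
    (freeResolvent c hc f : L2) =
      fourierMul (resolventSymbol c) (memLp_top_resolventSymbol hc) f := rfl

theorem isResolventAt_freeResolvent {c : ℝ} (hc : c ^ 2 = 1) :
    IsResolventAt freeOp (2 * Real.pi * c * Complex.I) (freeResolvent c hc) := by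
  have hpi : (Real.pi : ℂ) ≠ 0 := by exact_mod_cast Real.pi_ne_zero
  have hmem : ∀ f, freeResolvent c hc f ∈ freeOp.domain := fun f => by
    change MemSobolev 1 2 ((freeResolvent c hc f : L2) : 𝓢'(ℝ, ℂ))
    rw [coe_freeResolvent, fourierMul_resolventSymbol hc]
    exact memSobolev_fourierMul_besselSymbol _
  have hsub : ∀ φ : freeOp.domain, (𝓕 ((freeOp φ - (2 * Real.pi * c * Complex.I) • (φ : hardy) :
      hardy) : L2) : L2) =ᵐ[volume]
      fun ξ => (2 * Real.pi * (ξ - c * Complex.I)) * (𝓕 ((φ : hardy) : L2) : L2) ξ := fun φ => by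
    have h : (𝓕 ((freeOp φ - (2 * Real.pi * c * Complex.I) • (φ : hardy) : hardy) : L2) : L2) =
        𝓕 (freeOp φ : L2) - (2 * Real.pi * c * Complex.I) • (𝓕 ((φ : hardy) : L2) : L2) := by
      change Lp.fourierTransformₗᵢ ℝ ℂ ((freeOp φ : L2) -
        (2 * Real.pi * c * Complex.I) • ((φ : hardy) : L2)) = _
      rw [map_sub, map_smul]
      rfl
    rw [h]
    filter_upwards [Lp.coeFn_sub (𝓕 (freeOp φ : L2) : L2)
        ((2 * Real.pi * c * Complex.I) • (𝓕 ((φ : hardy) : L2) : L2)),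
      Lp.coeFn_smul (2 * Real.pi * c * Complex.I) (𝓕 ((φ : hardy) : L2) : L2),
      freeOp_coeFn φ] with ξ h1 h2 h3
    rw [h1, Pi.sub_apply, h2, h3, Pi.smul_apply, smul_eq_mul]
    push_cast
    ring
  have hne : ∀ ξ : ℝ, (2 * Real.pi * (ξ - c * Complex.I) : ℂ) ≠ 0 := fun ξ =>
    mul_ne_zero (mul_ne_zero two_ne_zero hpi) (sub_mul_I_ne_zero hc ξ)
  refine ⟨hmem, fun f => Subtype.ext (eq_of_fourier_ae_eq ?_),
    fun φ => Subtype.ext (eq_of_fourier_ae_eq ?_)⟩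
  · filter_upwards [hsub ⟨_, hmem f⟩, fourierMul_coeFn (resolventSymbol c)
      (memLp_top_resolventSymbol hc) f] with ξ h1 h2
    rw [h1]
    simp only [coe_freeResolvent, h2]
    rw [resolventSymbol, mul_inv_cancel_left₀ (hne ξ)]
  · rw [coe_freeResolvent]
    filter_upwards [hsub φ, fourierMul_coeFn (resolventSymbol c)
      (memLp_top_resolventSymbol hc) ((freeOp φ - (2 * Real.pi * c * Complex.I) • (φ : hardy) :
      hardy) : L2)] with ξ h1 h2
    rw [h2, h1, resolventSymbol, inv_mul_cancel_left₀ (hne ξ)]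

/-! ### Compactness of v(x) m(D) -/

section FourierKernel

variable {m : ℝ → ℂ}

theorem norm_exp_two_pi_mul_I (x ξ : ℝ) :
    ‖Complex.exp ((2 * Real.pi * (ξ * x) : ℝ) * Complex.I)‖ = 1 :=
  Complex.norm_exp_ofReal_mul_I _

/-- The conjugate offsets the conjugate linearity of the inner product in its first argument. -/
theorem memLp_fourierKernel (hm : MemLp m 2 (volume : Measure ℝ)) (x : ℝ) :
    MemLp (fun ξ : ℝ => starRingEnd ℂ (Complex.exp ((2 * Real.pi * (ξ * x) : ℝ) * Complex.I) * m ξ))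
      2 (volume : Measure ℝ) := by
  have hc : Continuous fun ξ : ℝ => Complex.exp ((2 * Real.pi * (ξ * x) : ℝ) * Complex.I) := by
    fun_prop
  refine hm.congr_norm (Complex.continuous_conj.comp_aestronglyMeasurable
    (hc.aestronglyMeasurable.mul hm.aestronglyMeasurable)) (.of_forall fun ξ => ?_)
  rw [RCLike.norm_conj, norm_mul, norm_exp_two_pi_mul_I, one_mul]

/-- The element of `L²(ℝ)` representing the functional `g ↦ 𝓕⁻ (m g) x`. -/
noncomputable def fourierKernel (hm : MemLp m 2 (volume : Measure ℝ)) (x : ℝ) : L2 :=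
  (memLp_fourierKernel hm x).toLp _

theorem inner_fourierKernel (hm : MemLp m 2 (volume : Measure ℝ)) (x : ℝ) (g : L2) :
    inner ℂ (fourierKernel hm x) g =
      ∫ ξ : ℝ, Complex.exp ((2 * Real.pi * (ξ * x) : ℝ) * Complex.I) * (m ξ * g ξ) := by
  rw [L2.inner_def]
  refine integral_congr_ae ?_
  filter_upwards [(memLp_fourierKernel hm x).coeFn_toLp] with ξ h
  rw [fourierKernel, h, RCLike.inner_apply, Complex.conj_conj]
  ring

theorem norm_sq_eq_integral (f : L2) : ‖f‖ ^ 2 = ∫ x, ‖f x‖ ^ 2 := by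
  have h : ((‖f‖ ^ 2 : ℝ) : ℂ) = ((∫ x, ‖f x‖ ^ 2 : ℝ) : ℂ) := by
    have := inner_self_eq_norm_sq_to_K (𝕜 := ℂ) f
    rw [L2.inner_def] at this
    rw [← integral_complex_ofReal]
    push_cast
    refine this.symm.trans (integral_congr_ae (.of_forall fun x => ?_))
    simp only
    rw [inner_self_eq_norm_sq_to_K]
    rfl
  exact_mod_cast h

theorem norm_fourierKernel (hm : MemLp m 2 (volume : Measure ℝ)) (x : ℝ) :
    ‖fourierKernel hm x‖ = ‖hm.toLp m‖ := by
  rw [fourierKernel, Lp.norm_toLp, Lp.norm_toLp]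
  congr 1
  refine eLpNorm_congr_norm_ae (.of_forall fun ξ => ?_)
  rw [RCLike.norm_conj, norm_mul, norm_exp_two_pi_mul_I, one_mul]

/-- Dominated convergence with bound (‖m‖ + ‖m‖)² = 4‖m‖². Continuity is what makes the
functional-valued kernel strongly measurable. -/
theorem continuous_fourierKernel (hm : MemLp m 2 (volume : Measure ℝ)) :
    Continuous (fourierKernel hm) := by
  refine continuous_iff_continuousAt.mpr fun y => ?_
  rw [ContinuousAt, tendsto_iff_norm_sub_tendsto_zero]
  have hsq : ∀ x, ‖fourierKernel hm x - fourierKernel hm y‖ ^ 2 = ∫ ξ : ℝ,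
      ‖Complex.exp ((2 * Real.pi * (ξ * x) : ℝ) * Complex.I) * m ξ -
        Complex.exp ((2 * Real.pi * (ξ * y) : ℝ) * Complex.I) * m ξ‖ ^ 2 := fun x => by
    rw [norm_sq_eq_integral]
    refine integral_congr_ae ?_
    filter_upwards [Lp.coeFn_sub (fourierKernel hm x) (fourierKernel hm y),
      (memLp_fourierKernel hm x).coeFn_toLp, (memLp_fourierKernel hm y).coeFn_toLp] with ξ h1 h2 h3
    rw [h1, Pi.sub_apply, fourierKernel, fourierKernel, h2, h3, ← map_sub, RCLike.norm_conj]
  have hcont : Continuous fun x => ‖fourierKernel hm x - fourierKernel hm y‖ ^ 2 := by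
    simp only [hsq]
    have hmeas : ∀ x : ℝ, AEStronglyMeasurable
        (fun ξ : ℝ => Complex.exp ((2 * Real.pi * (ξ * x) : ℝ) * Complex.I) * m ξ) volume := by
      intro x
      have hc : Continuous fun ξ : ℝ => Complex.exp ((2 * Real.pi * (ξ * x) : ℝ) * Complex.I) := by
        fun_prop
      exact hc.aestronglyMeasurable.mul hm.aestronglyMeasurable
    refine continuous_of_dominated (bound := fun ξ => 4 * ‖m ξ‖ ^ 2)
      (fun x => ((hmeas x).sub (hmeas y)).norm.pow 2) (fun x => .of_forall fun ξ => ?_)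
      (((memLp_two_iff_integrable_sq_norm hm.aestronglyMeasurable).mp hm).const_mul 4)
      (.of_forall fun ξ => by fun_prop)
    have h := norm_sub_le (Complex.exp ((2 * Real.pi * (ξ * x) : ℝ) * Complex.I) * m ξ)
      (Complex.exp ((2 * Real.pi * (ξ * y) : ℝ) * Complex.I) * m ξ)
    rw [norm_mul, norm_mul, norm_exp_two_pi_mul_I, norm_exp_two_pi_mul_I, one_mul] at h
    rw [Real.norm_of_nonneg (by positivity)]
    calc _ ≤ (‖m ξ‖ + ‖m ξ‖) ^ 2 := by gcongr
      _ = _ := by ring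
  have h := hcont.tendsto y
  rw [sub_self, norm_zero, zero_pow two_ne_zero] at h
  have h2 := (Real.continuous_sqrt.tendsto 0).comp h
  rw [Real.sqrt_zero] at h2
  exact h2.congr fun x => Real.sqrt_sq (norm_nonneg _)

theorem memLp_smul_innerSL_fourierKernel (hm : MemLp m 2 (volume : Measure ℝ)) {v : ℝ → ℂ}
    (hv : MemLp v 2 (volume : Measure ℝ)) :
    MemLp (fun x => v x • innerSL ℂ (fourierKernel hm x)) 2 (volume : Measure ℝ) := by
  refine (hv.norm.mul_const ‖hm.toLp m‖).mono (hv.aestronglyMeasurable.smul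
    ((innerSL ℂ).continuous.comp (continuous_fourierKernel hm)).aestronglyMeasurable)
    (.of_forall fun x => ?_)
  rw [norm_smul, innerSL_apply_norm, norm_fourierKernel, norm_mul, norm_norm, norm_norm]

/-- The operator `v(x) m(D)` on `L²(ℝ)` is compact if `v` and `m` are bounded and square
integrable. -/
theorem isCompactOperator_mulOp_comp_fourierMul {v : ℝ → ℂ}
    (hv₂ : MemLp v 2 (volume : Measure ℝ)) (hv : MemLp v ∞ (volume : Measure ℝ))
    (hgrowth : m.HasTemperateGrowth) (hm₂ : MemLp m 2 (volume : Measure ℝ))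
    (hm : MemLp m ∞ (volume : Measure ℝ)) :
    IsCompactOperator (mulOp v hv ∘L fourierMul m hm) := by
  set F := (Lp.fourierTransformₗᵢ ℝ ℂ).toContinuousLinearEquiv.toContinuousLinearMap
  set G := (Lp.fourierTransformₗᵢ ℝ ℂ).symm.toContinuousLinearEquiv.toContinuousLinearMap
  set T := (((ContinuousLinearMap.apply ℂ ℂ : L2 →L[ℂ] (L2 →L[ℂ] ℂ) →L[ℂ] ℂ)).compLpL₂ 2
    volume).flip ((memLp_smul_innerSL_fourierKernel hm₂ hv₂).toLp _) with hT
  suffices h : mulOp v hv ∘L G ∘L mulOp m hm = T by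
    change IsCompactOperator ((mulOp v hv ∘L G ∘L mulOp m hm) ∘ F)
    rw [h]
    exact (isCompactOperator_compLpL₂_flip _).comp_clm F
  ext1 f
  -- Both sides are continuous, so Schwartz functions suffice; for them the inverse Fourier
  -- transform is given pointwise by its integral.
  refine DenseRange.induction_on
    (SchwartzMap.denseRange_toLpCLM (E := ℝ) (F := ℂ) (p := 2) ENNReal.ofNat_ne_top) f
    (isClosed_eq (ContinuousLinearMap.continuous _) (ContinuousLinearMap.continuous _)) fun g => ?_
  rw [SchwartzMap.toLpCLM_apply]
  have hmul : mulOp m hm (g.toLp 2) = (SchwartzMap.smulLeftCLM ℂ m g).toLp 2 := by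
    apply Lp.ext
    filter_upwards [mulOp_coeFn m hm (g.toLp 2), g.coeFn_toLp 2,
      (SchwartzMap.smulLeftCLM ℂ m g).coeFn_toLp 2] with ξ h1 h2 h3
    rw [h1, h2, h3, SchwartzMap.smulLeftCLM_apply_apply hgrowth, smul_eq_mul]
  have hG : G (mulOp m hm (g.toLp 2)) = (𝓕⁻ (SchwartzMap.smulLeftCLM ℂ m g)).toLp 2 := by
    rw [hmul]
    exact SchwartzMap.toLp_fourierInv_eq _
  apply Lp.ext
  rw [ContinuousLinearMap.comp_apply, ContinuousLinearMap.comp_apply, hG]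
  filter_upwards [mulOp_coeFn v hv ((𝓕⁻ (SchwartzMap.smulLeftCLM ℂ m g)).toLp 2),
    (𝓕⁻ (SchwartzMap.smulLeftCLM ℂ m g)).coeFn_toLp 2,
    ((ContinuousLinearMap.apply ℂ ℂ : L2 →L[ℂ] (L2 →L[ℂ] ℂ) →L[ℂ] ℂ) (g.toLp 2)).coeFn_compLp
      ((memLp_smul_innerSL_fourierKernel hm₂ hv₂).toLp _),
    (memLp_smul_innerSL_fourierKernel hm₂ hv₂).coeFn_toLp] with x h1 h2 h3 h4
  rw [h1, h2]
  refine Eq.trans ?_ h3.symm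
  rw [h4, ContinuousLinearMap.apply_apply, smul_apply, innerSL_apply_apply,
    inner_fourierKernel, smul_eq_mul, SchwartzMap.fourierInv_coe, Real.fourierInv_eq']
  congr 1
  refine integral_congr_ae ?_
  filter_upwards [g.coeFn_toLp 2] with ξ hξ
  rw [hξ, SchwartzMap.smulLeftCLM_apply_apply hgrowth, smul_eq_mul, smul_eq_mul,
    RCLike.inner_apply, conj_trivial, mul_comm x ξ]

end FourierKernel

/-! ### Relative compactness and self-adjointness -/

/-- With b the Bessel symbol and q the bounded quotient, C₊ u C₊ b(D) q(D) = C₊ (u b(D)) C₊ q(D),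
and the bracket is compact. -/
theorem isCompactOperator_toeplitz_comp_freeResolvent {u : ℝ → ℝ}
    (hu₂ : MemLp u 2 (volume : Measure ℝ)) (hu : MemLp u ∞ (volume : Measure ℝ)) {c : ℝ}
    (hc : c ^ 2 = 1) : IsCompactOperator (toeplitz u hu ∘ freeResolvent c hc) := by
  have h := ((isCompactOperator_mulOp_comp_fourierMul (v := fun x => (u x : ℂ)) hu₂.ofReal hu.ofReal
    hasTemperateGrowth_besselSymbol memLp_two_besselSymbol memLp_top_besselSymbol).comp_clm
    (cauchyProj ∘L fourierMul _ (memLp_top_resolventSymbol_div hc) ∘L hardy.subtypeL)).clm_comp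
    cauchyProj
  convert! h.codRestrict (V := hardy) (fun _ => cauchyProj_mem_hardy _) isClosed_hardy using 1
  funext f
  refine Subtype.ext ?_
  change cauchyProj (mulOp _ _ (cauchyProj (freeResolvent c hc f : L2))) =
    cauchyProj (mulOp _ _ (fourierMul _ _ (cauchyProj (fourierMul _ _ (f : L2)))))
  rw [coe_freeResolvent, fourierMul_resolventSymbol hc, cauchyProj_eq_fourierMul,
    fourierMul_comm _ memLp_top_besselSymbol]

theorem isRelativelyCompact_potential {u : ℝ → ℝ} (hu₂ : MemLp u 2 (volume : Measure ℝ))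
    (hu : MemLp u ∞ (volume : Measure ℝ)) : IsRelativelyCompact freeOp (potential u hu) := by
  have hc : (1 : ℝ) ^ 2 = 1 := one_pow 2
  refine ⟨le_top, ⟨_, _, isResolventAt_freeResolvent hc⟩, fun z R hR => ?_⟩
  -- The resolvent identity reads R = R₀(1 + (z - 2πi) R), with R₀ the resolvent at 2πi.
  have h := (isCompactOperator_toeplitz_comp_freeResolvent hu₂ hu hc).comp_clm
    (ContinuousLinearMap.id ℂ hardy + (z - 2 * Real.pi * (1 : ℝ) * Complex.I) • R)
  convert! h using 1
  funext f
  exact congrArg (toeplitz u hu) ((isResolventAt_freeResolvent hc).apply_eq hR f)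

theorem isSelfAdjoint_laxOp (u : ℝ → ℝ) (hu : MemLp u ∞ (volume : Measure ℝ)) :
    IsSelfAdjoint (laxOp u hu) := by
  refine isSelfAdjoint_sub_of_isResolventAt freeOp_isFormalAdjoint
    (isResolventAt_freeResolvent (one_pow 2)) (S := freeResolvent (-1) (by norm_num)) ?_
    (toeplitz_isSymmetric u hu)
  -- The conjugate of 2πi is -2πi, the case c = -1.
  convert! isResolventAt_freeResolvent (c := -1) (by norm_num) using 1
  simp [map_ofNat]

end BenjaminOno

theorem theorem1 (u : ℝ → ℝ) (hu₂ : MeasureTheory.MemLp u 2 MeasureTheory.volume)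
    (hu : MeasureTheory.MemLp u ⊤ MeasureTheory.volume) :
    BenjaminOno.IsRelativelyCompact BenjaminOno.freeOp (BenjaminOno.potential u hu) ∧
      IsSelfAdjoint (BenjaminOno.laxOp u hu) ∧
      (BenjaminOno.laxOp u hu).domain = BenjaminOno.hardySobolev :=
  ⟨BenjaminOno.isRelativelyCompact_potential hu₂ hu, BenjaminOno.isSelfAdjoint_laxOp u hu,
    inf_top_eq _⟩
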